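/- Consider $n \ge 3$ anonymous robots, which are points of $\mathbb{R}^2$ and run the same deterministic algorithm. Each robot carries a light that shows one of two colors $A, B$ and that persists between its activations; the robots have no other memory. In each round exactly one robot is active, and the robots are activated one after the other in a fixed cyclic order of all $n$ robots, chosen by an adversary (ROUND-ROBIN). The active robot sees the color of its own light and the set of points occupied by robots, but neither the colors of the lights of other robots nor the number of robots on a point, including its own location (internal-light, set-view, no multiplicity detection). It perceives these points in a coordinate system of its own, with itself at the origin; the unit of length, the directions of the axes and the handedness of these systems are arbitrary, need not agree between robots (no chirality), and may even differ between activations of the same robot. From this information alone the algorithm computes a new color of the robot's light and a destination point; the robot sets its light to that color and moves exactly to that point (rigid movement) before the next round begins. Then Gathering is solvable: there is an algorithm, not depending on $n$, such that for all $n \ge 3$, all (not necessarily distinct) initial positions of the robots, all activation orders and all local coordinate systems, if the lights of all robots initially have color $A$, then after finitely many rounds all robots are located at one point, not prescribed in advance, and remain there forever. -/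

import Mathlib

/-- The Euclidean plane in which the robots live. -/
abbrev Plane : Type := EuclideanSpace ℝ (Fin 2)

/-- The private unit of length, axis directions and handedness of a robot. The linear isometry may
reverse orientation, so there is no agreement on chirality. -/
structure LocalFrame where
  scale : ℝ
  scale_pos : 0 < scale
  iso : Plane ≃ₗᵢ[ℝ] Plane

namespace LocalFrame

/-- The coordinates of the point `x` for a robot that is located at `o`: the robot itself is at the
origin of its coordinate system. -/
noncomputable def toLocal (f : LocalFrame) (o x : Plane) : Plane :=
  f.scale • f.iso (x - o)

/-- The point of the plane whose local coordinates are `y`, for a robot that is located at `o`. -/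
noncomputable def ofLocal (f : LocalFrame) (o y : Plane) : Plane :=
  o + f.iso.symm (f.scale⁻¹ • y)

theorem ofLocal_toLocal (f : LocalFrame) (o x : Plane) : f.ofLocal o (f.toLocal o x) = x := by
  simp [ofLocal, toLocal, smul_smul, f.scale_pos.ne']

theorem toLocal_ofLocal (f : LocalFrame) (o y : Plane) : f.toLocal o (f.ofLocal o y) = y := by
  simp [ofLocal, toLocal, smul_smul, f.scale_pos.ne']

end LocalFrame

/-- A configuration of `n` robots: the color of the light and the position of each robot. -/
@[ext] structure Configuration (L : Type) (n : ℕ) where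
  color : Fin n → L
  pos : Fin n → Plane

/-- What a robot perceives in the internal-light model with set-view: the color of its own light and
the set of all occupied points in its own coordinates. No color of another robot is visible, the
number of robots on a point is not visible, and since the robot itself always occupies the origin,
it does not perceive either whether other robots share its location. -/
structure Snapshot (L : Type) where
  ownColor : L
  points : Set Plane

/-- A deterministic algorithm, the same for all robots: it maps a snapshot to a new color of the
robot's light and a destination in the robot's own coordinates. -/
def Algorithm (L : Type) : Type := Snapshot L → L × Plane

namespace Configuration

variable {L : Type} {n : ℕ}

/-- The Look operation of robot `i`, which uses the frame `f`. -/
noncomputable def look (C : Configuration L n) (f : LocalFrame) (i : Fin n) : Snapshot L where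
  ownColor := C.color i
  points := Set.range fun j => f.toLocal (C.pos i) (C.pos j)

/-- One full Look-Compute-Move cycle of robot `i` with rigid movement (the robot reaches its
destination); no other robot changes. -/
noncomputable def step (alg : Algorithm L) (C : Configuration L n) (f : LocalFrame) (i : Fin n) :
    Configuration L n where
  color := Function.update C.color i (alg (C.look f i)).1
  pos := Function.update C.pos i (f.ofLocal (C.pos i) (alg (C.look f i)).2)

end Configuration

/-- The execution of `alg` from `C₀` in which robot `sched t` is the only one that is active in round
`t`, and uses the frame `frame t (sched t)`. -/
noncomputable def execution {L : Type} {n : ℕ} (alg : Algorithm L) (C₀ : Configuration L n)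
    (sched : ℕ → Fin n) (frame : ℕ → Fin n → LocalFrame) : ℕ → Configuration L n
  | 0 => C₀
  | t + 1 => (execution alg C₀ sched frame t).step alg (frame t (sched t)) (sched t)

/-- The ROUND-ROBIN scheduler: one robot is active in each round, each robot exactly once in the
first `n` rounds, and the same sequence is repeated forever. -/
def IsRoundRobin {n : ℕ} (sched : ℕ → Fin n) : Prop :=
  (∀ i : Fin n, ∃! k : ℕ, k < n ∧ sched k = i) ∧ ∀ t : ℕ, sched (t + n) = sched t

/-- From some round on, all robots are, and stay, at one and the same point. -/
def Gathers {L : Type} {n : ℕ} (E : ℕ → Configuration L n) : Prop :=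
  ∃ (T : ℕ) (z : Plane), ∀ t : ℕ, T ≤ t → ∀ i : Fin n, (E t).pos i = z

/-! Color records whether a robot has already made its one outward move. Unless all robots start
together, each jumps in the first cycle so far out that its new point is remote; its jump leaves at
least two occupied points, so the next robot jumps too (`first_cycle`). After this cycle all lights
are `1` and the last mover is remote. In the second cycle the other robots join it one by one: the
occupied set only loses non-remote positions, so the target stays remote (`second_cycle`). The
target needs no agreement between frames: both properties are invariant under similarities, and at
most one remote point differs from the observer's location (`IsRemote.eq_of_ne`). -/

/-- The distance from `r` to every other point of `S` exceeds all distances among the other points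
of `S`. -/
def IsRemote (S : Set Plane) (r : Plane) : Prop :=
  ∀ a ∈ S, ∀ b ∈ S, ∀ c ∈ S, a ≠ r → b ≠ r → c ≠ r → dist a b < dist r c

/-- The distance from `y` to every point of `S` exceeds all distances within `S`. -/
def IsFar (S : Set Plane) (y : Plane) : Prop :=
  ∀ a ∈ S, ∀ b ∈ S, ∀ c ∈ S, dist a b < dist y c

/-- A robot of color `0` that sees another point moves to a far point and takes color `1`. A robot
of color `1` moves to a remote point other than its own location, if there is one. -/
noncomputable def remoteAlgorithm : Algorithm (Fin 2) := fun s =>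
  open Classical in
  if s.ownColor = 0 then
    if h : (∃ x ∈ s.points, x ≠ 0) ∧ ∃ y, IsFar s.points y then (1, h.2.choose) else (0, 0)
  else
    if h : ∃ r ∈ s.points, r ≠ 0 ∧ IsRemote s.points r then (1, h.choose) else (1, 0)

theorem exists_isFar {S : Set Plane} (hS : Bornology.IsBounded S) : ∃ y, IsFar S y := by
  obtain ⟨R, hR⟩ := hS.exists_norm_le
  -- Distances within `S` are at most `2 * |R|`, those from this point to `S` at least `2 * |R| +
  -- 1`.
  refine ⟨EuclideanSpace.single 0 (3 * |R| + 1), fun a ha b hb c hc => ?_⟩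
  have hy : ‖(EuclideanSpace.single 0 (3 * |R| + 1) : Plane)‖ = 3 * |R| + 1 := by
    rw [PiLp.norm_single, Real.norm_eq_abs, abs_of_pos (by positivity)]
  have h₁ := norm_sub_le a b
  have h₂ := norm_sub_norm_le (EuclideanSpace.single 0 (3 * |R| + 1) : Plane) c
  rw [dist_eq_norm, dist_eq_norm]
  linarith [hR a ha, hR b hb, hR c hc, le_abs_self R]

/-- Two distinct remote points would each have to be strictly farther from `o` than the other. The
role of `o` is the observer's location; with only two occupied points both are remote, but one of
them is `o`. -/
theorem IsRemote.eq_of_ne {S : Set Plane} {r r' o : Plane} (h : IsRemote S r)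
    (h' : IsRemote S r') (hr : r ∈ S) (hr' : r' ∈ S) (ho : o ∈ S) (hor : o ≠ r) (hor' : o ≠ r') :
    r = r' := by
  by_contra hne
  have h₁ := h r' hr' o ho o ho (Ne.symm hne) hor hor
  have h₂ := h' r hr o ho o ho hne hor' hor'
  exact lt_asymm h₁ h₂

/-! ### Invariance under local frames -/

namespace LocalFrame

theorem dist_toLocal (f : LocalFrame) (o x y : Plane) :
    dist (f.toLocal o x) (f.toLocal o y) = f.scale * dist x y := by
  simp only [toLocal, dist_smul₀, LinearIsometryEquiv.dist_map, dist_sub_right,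
    Real.norm_of_nonneg f.scale_pos.le]

theorem toLocal_inj (f : LocalFrame) {o x y : Plane} :
    f.toLocal o x = f.toLocal o y ↔ x = y :=
  ⟨fun h => by rw [← f.ofLocal_toLocal o x, h, f.ofLocal_toLocal], fun h => h ▸ rfl⟩

theorem toLocal_self (f : LocalFrame) (o : Plane) : f.toLocal o o = 0 := by
  simp [toLocal]

theorem toLocal_eq_zero (f : LocalFrame) {o x : Plane} : f.toLocal o x = 0 ↔ x = o := by
  rw [← f.toLocal_self o, f.toLocal_inj]

theorem ofLocal_zero (f : LocalFrame) (o : Plane) : f.ofLocal o 0 = o := by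
  simp [ofLocal]

theorem isFar_image (f : LocalFrame) (o y : Plane) (S : Set Plane) :
    IsFar (f.toLocal o '' S) (f.toLocal o y) ↔ IsFar S y := by
  simp only [IsFar, Set.forall_mem_image, dist_toLocal, mul_lt_mul_iff_right₀ f.scale_pos]

theorem isRemote_image (f : LocalFrame) (o r : Plane) (S : Set Plane) :
    IsRemote (f.toLocal o '' S) (f.toLocal o r) ↔ IsRemote S r := by
  simp only [IsRemote, Set.forall_mem_image, dist_toLocal, mul_lt_mul_iff_right₀ f.scale_pos, ne_eq,
    toLocal_inj]

end LocalFrame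

/-! ### Effect of a single round -/

namespace Configuration

variable {n : ℕ}

theorem look_points {L : Type} (C : Configuration L n) (f : LocalFrame) (i : Fin n) :
    (C.look f i).points = f.toLocal (C.pos i) '' Set.range C.pos := by
  rw [look, ← Set.range_comp]
  rfl

theorem step_far (C : Configuration (Fin 2) n) (f : LocalFrame) (i : Fin n)
    (hi : C.color i = 0) (hne : ∃ j, C.pos j ≠ C.pos i) :
    ∃ y, IsFar (Set.range C.pos) y ∧
      C.step remoteAlgorithm f i = ⟨Function.update C.color i 1, Function.update C.pos i y⟩ := by
  have h : (∃ x ∈ (C.look f i).points, x ≠ 0) ∧ ∃ y, IsFar (C.look f i).points y := by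
    refine ⟨?_, exists_isFar (Set.finite_range _).isBounded⟩
    obtain ⟨j, hj⟩ := hne
    exact ⟨_, ⟨j, rfl⟩, fun h => hj (f.toLocal_eq_zero.1 h)⟩
  have halg : remoteAlgorithm (C.look f i) = (1, h.2.choose) := by
    rw [remoteAlgorithm, if_pos (show (C.look f i).ownColor = 0 from hi), dif_pos h]
  refine ⟨f.ofLocal (C.pos i) h.2.choose, ?_, by rw [step, halg]⟩
  rw [← f.isFar_image (C.pos i), f.toLocal_ofLocal, ← look_points]
  exact h.2.choose_spec

theorem step_remote (C : Configuration (Fin 2) n) (f : LocalFrame) (i k : Fin n)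
    (hi : C.color i = 1) (hk : C.pos i ≠ C.pos k) (hr : IsRemote (Set.range C.pos) (C.pos k)) :
    C.step remoteAlgorithm f i =
      ⟨Function.update C.color i 1, Function.update C.pos i (C.pos k)⟩ := by
  have h : ∃ r ∈ (C.look f i).points, r ≠ 0 ∧ IsRemote (C.look f i).points r := by
    refine ⟨f.toLocal (C.pos i) (C.pos k), ⟨k, rfl⟩, fun h => hk (f.toLocal_eq_zero.1 h).symm, ?_⟩
    rwa [look_points, f.isRemote_image]
  have halg : remoteAlgorithm (C.look f i) = (1, h.choose) := by
    rw [remoteAlgorithm, if_neg (by simp [look, hi]), dif_pos h]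
  -- Uniqueness makes the arbitrary choice harmless.
  have hdest : f.ofLocal (C.pos i) h.choose = C.pos k := by
    obtain ⟨⟨j, hj⟩, hne, hrem⟩ := h.choose_spec
    rw [← hj] at hne hrem ⊢
    rw [look_points, f.isRemote_image] at hrem
    rw [f.ofLocal_toLocal]
    exact hrem.eq_of_ne hr ⟨j, rfl⟩ ⟨k, rfl⟩ ⟨i, rfl⟩
      (fun h => hne (f.toLocal_eq_zero.2 h.symm)) hk
  rw [step, halg, hdest]

theorem step_gathered (C : Configuration (Fin 2) n) (f : LocalFrame) (i : Fin n)
    (h : ∀ j, C.pos j = C.pos i) : C.step remoteAlgorithm f i = C := by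
  have hz : ∀ x ∈ (C.look f i).points, x = 0 := by
    rintro _ ⟨j, rfl⟩
    exact f.toLocal_eq_zero.2 (h j)
  have halg : remoteAlgorithm (C.look f i) = (C.color i, 0) := by
    have hc : (C.look f i).ownColor = C.color i := rfl
    rw [remoteAlgorithm, dif_neg (fun ⟨⟨x, hx, hx0⟩, _⟩ => hx0 (hz x hx)),
      dif_neg (fun ⟨x, hx, hx0, _⟩ => hx0 (hz x hx)), hc]
    split_ifs with h0
    · rw [h0]
    · rw [Fin.eq_one_of_ne_zero _ h0]
  rw [step, halg, f.ofLocal_zero, Function.update_eq_self, Function.update_eq_self]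

end Configuration

theorem IsRoundRobin.injOn {n : ℕ} {sched : ℕ → Fin n} (h : IsRoundRobin sched) {s t : ℕ}
    (hs : s < n) (ht : t < n) (hst : sched s = sched t) : s = t :=
  (h.1 (sched t)).unique ⟨hs, hst⟩ ⟨ht, rfl⟩

/-! ### The two cycles -/

section Execution

variable {n : ℕ} {C₀ : Configuration (Fin 2) n} {sched : ℕ → Fin n}
  {frame : ℕ → Fin n → LocalFrame}

theorem gathers_of_pos_eq {T : ℕ} {z : Plane}
    (h : ∀ i, (execution remoteAlgorithm C₀ sched frame T).pos i = z) :
    Gathers (execution remoteAlgorithm C₀ sched frame) := by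
  refine ⟨T, z, fun t ht => ?_⟩
  induction t, ht using Nat.le_induction with
  | base => exact h
  | succ t _ ih =>
    rw [execution, Configuration.step_gathered _ _ _ fun j => (ih j).trans (ih _).symm]
    exact ih

/-- In the first cycle every activated robot takes color `1` and moves to a far point. -/
theorem first_cycle (hs : IsRoundRobin sched) (h0 : ∀ i, C₀.color i = 0)
    (hne : ∃ i j, C₀.pos i ≠ C₀.pos j) {t : ℕ} (ht : t ≤ n) :
    (∃ i j, (execution remoteAlgorithm C₀ sched frame t).pos i ≠
      (execution remoteAlgorithm C₀ sched frame t).pos j) ∧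
    (∀ s < n, (execution remoteAlgorithm C₀ sched frame t).color (sched s) =
      if s < t then 1 else 0) ∧
    ∀ s, t = s + 1 → ∀ a b c, a ≠ sched s → b ≠ sched s → c ≠ sched s →
      dist ((execution remoteAlgorithm C₀ sched frame t).pos a)
          ((execution remoteAlgorithm C₀ sched frame t).pos b) <
        dist ((execution remoteAlgorithm C₀ sched frame t).pos (sched s))
          ((execution remoteAlgorithm C₀ sched frame t).pos c) := by
  induction t with
  | zero => exact ⟨hne, fun s _ => by simpa using! h0 _, fun s hs => by omega⟩
  | succ t ih =>
    obtain ⟨⟨i, j, hij⟩, hcol, -⟩ := ih (by omega)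
    have hex : ∃ j, (execution remoteAlgorithm C₀ sched frame t).pos j ≠
        (execution remoteAlgorithm C₀ sched frame t).pos (sched t) := by
      by_contra! hall
      exact hij ((hall i).trans (hall j).symm)
    obtain ⟨y, hy, hstep⟩ := Configuration.step_far _ (frame t (sched t)) (sched t)
      (by simpa using hcol t (by omega)) hex
    rw [execution, hstep]
    have hfar : ∀ a b c, a ≠ sched t → b ≠ sched t → c ≠ sched t →
        dist (Function.update (execution remoteAlgorithm C₀ sched frame t).pos (sched t) y a)
            (Function.update (execution remoteAlgorithm C₀ sched frame t).pos (sched t) y b) <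
          dist (Function.update (execution remoteAlgorithm C₀ sched frame t).pos (sched t) y
              (sched t))
            (Function.update (execution remoteAlgorithm C₀ sched frame t).pos (sched t) y c) := by
      intro a b c ha hb hc
      rw [Function.update_of_ne ha, Function.update_of_ne hb, Function.update_of_ne hc,
        Function.update_self]
      exact hy _ ⟨a, rfl⟩ _ ⟨b, rfl⟩ _ ⟨c, rfl⟩
    refine ⟨?_, fun s hsn => ?_, fun s hst => ?_⟩
    · obtain ⟨j, hj⟩ := hex
      have hjt : j ≠ sched t := fun h => hj (h ▸ rfl)
      -- The mover is now strictly away from a robot that stayed, so the robots are still not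
      -- gathered.
      exact ⟨sched t, j, dist_pos.1 (dist_nonneg.trans_lt (hfar j j j hjt hjt hjt))⟩
    · by_cases hst : s = t
      · simp [hst]
      · have : sched s ≠ sched t := fun h => hst (hs.injOn hsn (by omega) h)
        simp only [Function.update_of_ne this, hcol s hsn]
        congr 1
        simp only [eq_iff_iff]
        omega
    · obtain rfl : t = s := by omega
      exact hfar

/-- If all robots have color `1` and robot `l` is remote, then the robots that are activated join
robot `l` one by one. -/
theorem second_cycle {T : ℕ} {l : Fin n}
    (hcol : ∀ i, (execution remoteAlgorithm C₀ sched frame T).color i = 1)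
    (hrem : ∀ a b c, a ≠ l → b ≠ l → c ≠ l →
      dist ((execution remoteAlgorithm C₀ sched frame T).pos a)
          ((execution remoteAlgorithm C₀ sched frame T).pos b) <
        dist ((execution remoteAlgorithm C₀ sched frame T).pos l)
          ((execution remoteAlgorithm C₀ sched frame T).pos c))
    {k : ℕ} (hk : ∀ m < k, sched (T + m) ≠ l)
    (hinj : ∀ m < k, ∀ m' < k, sched (T + m) = sched (T + m') → m = m') :
    (∀ i, (execution remoteAlgorithm C₀ sched frame (T + k)).color i = 1) ∧
    (∀ i, (execution remoteAlgorithm C₀ sched frame (T + k)).pos i =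
      if ∃ m < k, sched (T + m) = i then (execution remoteAlgorithm C₀ sched frame T).pos l
      else (execution remoteAlgorithm C₀ sched frame T).pos i) := by
  induction k with
  | zero => simpa using hcol
  | succ k ih =>
    obtain ⟨ihcol, ihpos⟩ := ih (fun m hm => hk m (by omega))
      fun m hm m' hm' => hinj m (by omega) m' (by omega)
    have hl : (execution remoteAlgorithm C₀ sched frame (T + k)).pos l =
        (execution remoteAlgorithm C₀ sched frame T).pos l := by
      rw [ihpos, if_neg]
      rintro ⟨m, hm, h⟩
      exact hk m (by omega) h
    -- Away from the meeting point only positions from time `T` survive, so the inequalities `hrem`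
    -- still apply.
    have hold : ∀ x ∈ Set.range (execution remoteAlgorithm C₀ sched frame (T + k)).pos,
        x ≠ (execution remoteAlgorithm C₀ sched frame T).pos l →
        ∃ a, a ≠ l ∧ x = (execution remoteAlgorithm C₀ sched frame T).pos a := by
      rintro _ ⟨a, rfl⟩ hx
      refine ⟨a, fun h => hx (h ▸ hl), ?_⟩
      rw [ihpos] at hx ⊢
      split_ifs at hx ⊢
      · exact absurd rfl hx
      · rfl
    have hR : IsRemote (Set.range (execution remoteAlgorithm C₀ sched frame (T + k)).pos)
        ((execution remoteAlgorithm C₀ sched frame (T + k)).pos l) := by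
      rw [hl]
      intro x hx y hy z hz hxl hyl hzl
      obtain ⟨a, ha, rfl⟩ := hold x hx hxl
      obtain ⟨b, hb, rfl⟩ := hold y hy hyl
      obtain ⟨c, hc, rfl⟩ := hold z hz hzl
      exact hrem a b c ha hb hc
    have hstep : (execution remoteAlgorithm C₀ sched frame (T + (k + 1))) =
        ⟨Function.update (execution remoteAlgorithm C₀ sched frame (T + k)).color (sched (T + k)) 1,
          Function.update (execution remoteAlgorithm C₀ sched frame (T + k)).pos (sched (T + k))
            ((execution remoteAlgorithm C₀ sched frame T).pos l)⟩ := by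
      rw [← add_assoc, execution]
      have hne : (execution remoteAlgorithm C₀ sched frame (T + k)).pos (sched (T + k)) ≠
          (execution remoteAlgorithm C₀ sched frame (T + k)).pos l := by
        have hkl := hk k (by omega)
        rw [hl, ihpos, if_neg]
        · exact (dist_pos.1 (dist_nonneg.trans_lt (hrem _ _ _ hkl hkl hkl))).symm
        · rintro ⟨m, hm, h⟩
          exact hm.ne (hinj m (by omega) k (by omega) h)
      rw [Configuration.step_remote _ _ _ l (ihcol _) hne hR, hl]
    rw [hstep]
    refine ⟨fun i => ?_, fun i => ?_⟩
    · by_cases hi : i = sched (T + k)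
      · simp [hi]
      · simp [Function.update_of_ne hi, ihcol]
    · by_cases hi : i = sched (T + k)
      · have : ∃ m < k + 1, sched (T + m) = i := ⟨k, by omega, hi.symm⟩
        rw [if_pos this, hi]
        exact Function.update_self ..
      · simp only [Function.update_of_ne hi, ihpos]
        congr 1
        simp only [eq_iff_iff, Nat.lt_succ_iff_lt_or_eq]
        constructor
        · rintro ⟨m, hm, h⟩
          exact ⟨m, Or.inl hm, h⟩
        · rintro ⟨m, hm | rfl, h⟩
          · exact ⟨m, hm, h⟩
          · exact absurd h.symm hi

end Execution

theorem theorem10 :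
    ∃ (alg : Algorithm (Fin 2)) (c₀ : Fin 2),
      ∀ n : ℕ, 3 ≤ n → ∀ p₀ : Fin n → Plane,
        ∀ sched : ℕ → Fin n, IsRoundRobin sched →
          ∀ frame : ℕ → Fin n → LocalFrame,
            Gathers (execution alg { color := fun _ => c₀, pos := p₀ } sched frame) := by
  refine ⟨remoteAlgorithm, 0, fun n hn p₀ sched hs frame => ?_⟩
  by_cases hne : ∃ i j, p₀ i ≠ p₀ j
  · obtain ⟨-, hcol, hfar⟩ := first_cycle (frame := frame)
      (C₀ := { color := fun _ => 0, pos := p₀ }) hs (fun _ => rfl) hne le_rfl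
    have hper : ∀ m, sched (n + m) = sched m := fun m => by rw [add_comm, hs.2]
    have h₂ := second_cycle (k := n - 1) (fun i => by
        obtain ⟨s, ⟨hsn, rfl⟩, -⟩ := hs.1 i
        simpa [hsn] using hcol s hsn)
      (hfar (n - 1) (by omega)) (fun m hm h => by
        have := hs.injOn (by omega) (by omega) ((hper m).symm.trans h)
        omega)
      (fun m hm m' hm' h => hs.injOn (by omega) (by omega) (by rwa [hper, hper] at h))
    -- Only `n - 1` further rounds are needed: the target robot is last in the cyclic order.
    refine gathers_of_pos_eq (T := n + (n - 1))
      (z := (execution remoteAlgorithm { color := fun _ => 0, pos := p₀ } sched frame n).pos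
        (sched (n - 1))) fun i => (h₂.2 i).trans ?_
    split_ifs with hi
    · rfl
    · obtain ⟨s, ⟨hsn, rfl⟩, -⟩ := hs.1 i
      have : s = n - 1 := by
        by_contra hsn'
        exact hi ⟨s, by omega, hper s⟩
      rw [this]
  · push Not at hne
    exact gathers_of_pos_eq (T := 0) (z := p₀ ⟨0, by omega⟩) fun i => hne i _
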